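/- **Smooth calibration theorem.** Let $\Omega$ be a non-empty finite set, let $\Delta(\Omega)\subset\mathbb R^\Omega$ be the set of probability distributions on $\Omega$, and identify $\omega\in\Omega$ with the corresponding vertex of $\Delta(\Omega)$. At each stage $m\ge 1$ a forecaster chooses $p_m\in\Delta(\Omega)$ and Nature chooses $\omega_m\in\Omega$; the history before stage $m$ is $h^{m-1}=(p_1,\omega_1,\dots,p_{m-1},\omega_{m-1})$. A deterministic strategy $\sigma$ of the forecaster maps every finite history to a prediction in $\Delta(\Omega)$; a strategy $\tau$ of Nature maps every finite history to a probability distribution on $\Omega$, the law of the next outcome. Let $\mathbb P_{\sigma,\tau}$ be the law of the play that they induce. (1) There exists a deterministic strategy $\sigma$ such that, for every sequence of outcomes $(\omega_m)$ (hence whatever strategy Nature uses) and for every continuous $g:\Delta(\Omega)\to\mathbb R_+$, $$\lim_{n\to\infty}\frac1n\Big\|\sum_{m=1}^n g(p_m)(\omega_m-p_m)\Big\|=0 .$$ (2) A checking rule independent of the current prediction is a pair $(\mathcal U,\mathcal T)$ of maps from finite histories to subsets of $\Omega$ with $\mathcal T(h)\subset\mathcal U(h)$ for all $h$. The set of these rules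 carries the cylinder $\sigma$-algebra, generated by the evaluations $(\mathcal U,\mathcal T)\mapsto(\mathcal U(h),\mathcal T(h))$. For every probability measure $\mu$ on this set there exists a deterministic strategy $\sigma$ that satisfies (1) and such that, moreover, for every strategy $\tau$ of Nature and for $\mu$-almost every $(\mathcal U,\mathcal T)$, $\mathbb P_{\sigma,\tau}$-almost surely: $p_m\{\mathcal U(h^{m-1})\}>0$ at every stage $m$ with $\omega_m\in\mathcal U(h^{m-1})$, and for every continuous $g:\Delta(\Omega)\to\mathbb R_+$, $$\lim_{n\to\infty}\frac1n\Big|\sum_{m=1}^n g(p_m)\,\mathbf 1\{\omega_m\in\mathcal U(h^{m-1})\}\Big(\mathbf 1\{\omega_m\in\mathcal T(h^{m-1})\}-p_m\{\mathcal T(h^{m-1})\mid\mathcal U(h^{m-1})\}\Big)\Big|=0 .$$ -/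

import Mathlib

open Filter Topology MeasureTheory ProbabilityTheory

noncomputable section

/-- Finite histories: the past pairs (prediction, outcome), in chronological order. Predictions
live in `Δ(Ω) = stdSimplex ℝ Ω`. -/
abbrev ForecastHistory (Ω : Type*) [Fintype Ω] : Type _ :=
  List (stdSimplex ℝ Ω × Ω)

/-- A deterministic strategy of the forecaster: each finite history is mapped to one prediction. -/
abbrev DetForecaster (Ω : Type*) [Fintype Ω] : Type _ :=
  ForecastHistory Ω → stdSimplex ℝ Ω

/-- A (possibly randomized) strategy of Nature: each finite history is mapped to the law of the
next outcome. Deterministic strategies of Nature are those with values in point masses. -/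
abbrev NatureStrategy (Ω : Type*) [Fintype Ω] : Type _ :=
  ForecastHistory Ω → PMF Ω

/-- The history of the first `n` stages when the forecaster follows `σ` and the outcomes are
`ω 0, ω 1, …` (the stage called `m` in one-based counting has index `m - 1`). -/
def playHistory {Ω : Type*} [Fintype Ω] (σ : DetForecaster Ω) (ω : ℕ → Ω) :
    ℕ → ForecastHistory Ω
  | 0 => []
  | n + 1 => playHistory σ ω n ++ [(σ (playHistory σ ω n), ω n)]

/-- The prediction made at the stage of index `m`. -/
def prediction {Ω : Type*} [Fintype Ω] (σ : DetForecaster Ω) (ω : ℕ → Ω) (m : ℕ) :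
    stdSimplex ℝ Ω :=
  σ (playHistory σ ω m)

/-- Conditional law of the outcome of index `n + 1`, given the outcomes of index `0, …, n`, when
the forecaster plays `σ` and Nature plays `τ`. -/
def natureKernel {Ω : Type*} [Fintype Ω] [MeasurableSpace Ω] [DiscreteMeasurableSpace Ω]
    (σ : DetForecaster Ω) (τ : NatureStrategy Ω) (n : ℕ) :
    Kernel (Finset.Iic n → Ω) Ω :=
  Kernel.ofFunOfCountable fun w =>
    (τ (playHistory σ (fun i => w ⟨min i n, by simp⟩) (n + 1))).toMeasure

instance {Ω : Type*} [Fintype Ω] [MeasurableSpace Ω] [DiscreteMeasurableSpace Ω]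
    (σ : DetForecaster Ω) (τ : NatureStrategy Ω) (n : ℕ) :
    IsMarkovKernel (natureKernel σ τ n) :=
  ⟨fun w => by unfold natureKernel; exact PMF.toMeasure.isProbabilityMeasure _⟩

/-- The law of the outcome sequence induced by the pair of strategies `(σ, τ)`
(Ionescu-Tulcea). As `σ` is deterministic, it determines the law of the whole play. -/
def playLaw {Ω : Type*} [Fintype Ω] [MeasurableSpace Ω] [DiscreteMeasurableSpace Ω]
    (σ : DetForecaster Ω) (τ : NatureStrategy Ω) : Measure (ℕ → Ω) :=
  Kernel.trajMeasure (X := fun _ => Ω) (τ []).toMeasure (natureKernel σ τ)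

/-- The vertex of the simplex that corresponds to the outcome `a`. -/
def outcomeVec {Ω : Type*} (a : Ω) : Ω → ℝ :=
  Set.indicator {a} 1

/-- The smooth calibration score `(1/n) ‖∑ₘ g(pₘ) (ωₘ - pₘ)‖` after `n` stages, with the
Euclidean norm. -/
def smoothScore {Ω : Type*} [Fintype Ω] (g : stdSimplex ℝ Ω → ℝ) (σ : DetForecaster Ω)
    (ω : ℕ → Ω) (n : ℕ) : ℝ :=
  (1 / (n : ℝ)) * ‖WithLp.toLp 2 (∑ m ∈ Finset.range n,
    g (prediction σ ω m) • (outcomeVec (ω m) - (prediction σ ω m : Ω → ℝ)))‖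

/-- A checking rule that is independent of the current prediction: it maps each past history to
an active universe and a tested event contained in it. -/
structure CheckingRule (Ω : Type*) [Fintype Ω] where
  active : ForecastHistory Ω → Set Ω
  tested : ForecastHistory Ω → Set Ω
  tested_subset_active : ∀ h, tested h ⊆ active h

/-- The cylinder σ-algebra: the smallest one for which, for each finite history `h`, the values
`active h` and `tested h` are measurable. -/
instance {Ω : Type*} [Fintype Ω] : MeasurableSpace (CheckingRule Ω) :=
  MeasurableSpace.comap
    (fun c : CheckingRule Ω => fun h : ForecastHistory Ω => (c.active h, c.tested h)) inferInstance

/-- The probability `p{A}` of an event. -/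
def eventProb {Ω : Type*} [Fintype Ω] (p : stdSimplex ℝ Ω) (A : Set Ω) : ℝ :=
  ∑ a, A.indicator (p : Ω → ℝ) a

/-- The conditional probability `p{A | B}`; only meaningful if `0 < eventProb p B`. -/
def condEventProb {Ω : Type*} [Fintype Ω] (p : stdSimplex ℝ Ω) (A B : Set Ω) : ℝ :=
  eventProb p (A ∩ B) / eventProb p B

/-- The conditional predictions `pₘ{· | U(hᵐ⁻¹)}` are well defined at all the active stages, i.e.
the stages `m` with `ωₘ ∈ U(hᵐ⁻¹)`. -/
def ConditionalsDefined {Ω : Type*} [Fintype Ω] (c : CheckingRule Ω) (σ : DetForecaster Ω)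
    (ω : ℕ → Ω) : Prop :=
  ∀ m, ω m ∈ c.active (playHistory σ ω m) →
    0 < eventProb (prediction σ ω m) (c.active (playHistory σ ω m))

/-- The smooth calibration score with a checking rule `c = (U, T)`,
`(1/n) |∑ₘ g(pₘ) 1{ωₘ ∈ U(hᵐ⁻¹)} (1{ωₘ ∈ T(hᵐ⁻¹)} - pₘ{T(hᵐ⁻¹) | U(hᵐ⁻¹)})|`. -/
def checkedScore {Ω : Type*} [Fintype Ω] (c : CheckingRule Ω) (g : stdSimplex ℝ Ω → ℝ)
    (σ : DetForecaster Ω) (ω : ℕ → Ω) (n : ℕ) : ℝ :=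
  (1 / (n : ℝ)) * |∑ m ∈ Finset.range n,
    g (prediction σ ω m) * (c.active (playHistory σ ω m)).indicator 1 (ω m) *
      ((c.tested (playHistory σ ω m)).indicator 1 (ω m) -
        condEventProb (prediction σ ω m) (c.tested (playHistory σ ω m))
          (c.active (playHistory σ ω m)))|

end

/-! The method is defensive forecasting. Each test is a feature `X h p i a` with `p`-mean zero in
the outcome `a`. Let `S i` be its running sum and `ν` a finite measure on the tests. If the
prediction `p` makes `∫ S i * X h p i a ∂ν ≤ 1` for all `a`, then `∫ S i ^ 2 ∂ν` grows by at most `2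
+ ν.real univ` per stage, whatever the outcome.

Such a `p` exists because the field `F p a = ∫ S i * X h p i a ∂ν` is orthogonal to `p`: solve a
variational inequality for `F` on a slightly shrunken simplex (`exists_pos_forall_le_one`). The
inequality comes from Brouwer's theorem, itself proved by the Milnor–Rogers volume argument.
Shrinking keeps predictions strictly positive, where conditional probabilities are continuous.

The tests are pairs of a function from a countable family, whose multiples are dense, and a rule
distributed as `μ` plus unit atoms at the rules that test single outcomes. At an atom the bound
reads `S ^ 2 ≤ C * n` on every outcome sequence, which gives (1). For `μ`, integrating over plays
gives a second moment of order `n` under `μ.prod P`, and a strong law followed by Fubini gives (2).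
-/

/-! ### Brouwer's fixed point theorem and variational inequalities. -/

section Brouwer

variable {E : Type*} [NormedAddCommGroup E] [InnerProductSpace ℝ E] [FiniteDimensional ℝ E]

/-- The determinant of `1 + t A` is a polynomial in `t`, of degree at most the dimension. -/
theorem exists_polynomial_det_one_add_smul (A : E →L[ℝ] E) :
    ∃ P : Polynomial ℝ, P.natDegree ≤ Module.finrank ℝ E ∧
      ∀ t : ℝ, P.eval t = (1 + t • A).det := by
  classical
  set b := Module.finBasis ℝ E
  set M := LinearMap.toMatrix b b (A : E →ₗ[ℝ] E)
  refine ⟨((Polynomial.X : Polynomial ℝ) • M.map Polynomial.C +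
    (1 : Matrix (Fin (Module.finrank ℝ E)) (Fin (Module.finrank ℝ E)) ℝ).map Polynomial.C).det, ?_, fun t => ?_⟩
  · simpa using Polynomial.natDegree_det_X_add_C_le M 1
  · have h1 : (1 + t • A).det = (t • M + 1).det := by
      change LinearMap.det ((1 + t • A : E →L[ℝ] E) : E →ₗ[ℝ] E) = _
      rw [← LinearMap.det_toMatrix b]
      congr 1
      rw [add_comm]
      simp [M, ContinuousLinearMap.one_def]
    rw [h1, ← Polynomial.coe_evalRingHom, RingHom.map_det]
    congr 1
    ext i j
    by_cases hij : i = j <;> simp [hij] <;> ring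

/-- If `t ‖A‖ < 1` then `1 + t A` preserves the orientation. -/
theorem det_one_add_smul_pos (A : E →L[ℝ] E) {t : ℝ} (ht : 0 ≤ t) (hA : t * ‖A‖ < 1) :
    0 < (1 + t • A).det := by
  -- A kernel vector would satisfy `‖v‖ ≤ s * ‖A‖ * ‖v‖`, so the determinant has no zero on `[0, t]`
  -- and keeps its sign at `0`, where it is `1`.
  have hne : ∀ s ∈ Set.Icc 0 t, (1 + s • A).det ≠ 0 := by
    intro s hs hdet
    have hs' : s * ‖A‖ < 1 := lt_of_le_of_lt (by gcongr; exact hs.2) hA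
    have hker := (LinearMap.bot_lt_ker_of_det_eq_zero (f := ((1 + s • A : E →L[ℝ] E) : E →ₗ[ℝ] E))
      hdet)
    obtain ⟨v, hv, hv0⟩ := Submodule.exists_mem_ne_zero_of_ne_bot hker.ne'
    have hv1 : v + s • A v = 0 := by simpa using hv
    have : ‖v‖ ≤ s * ‖A‖ * ‖v‖ := by
      have h2 : v = -(s • A v) := eq_neg_of_add_eq_zero_left hv1
      calc ‖v‖ = ‖s • A v‖ := by conv_lhs => rw [h2, norm_neg]
        _ = s * ‖A v‖ := by rw [norm_smul, Real.norm_of_nonneg hs.1]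
        _ ≤ s * (‖A‖ * ‖v‖) := by gcongr; exacts [hs.1, A.le_opNorm v]
        _ = _ := by ring
    have hvpos : 0 < ‖v‖ := norm_pos_iff.2 hv0
    nlinarith
  have hcont : Continuous fun s : ℝ => (1 + s • A).det :=
    ContinuousLinearMap.continuous_det.comp (by fun_prop)
  by_contra hneg
  have h0 : (1 + (0 : ℝ) • A).det = 1 := by
    simp [ContinuousLinearMap.det, ContinuousLinearMap.one_def]
  have := intermediate_value_Icc' ht hcont.continuousOn
  obtain ⟨s, hs, hs0⟩ := this (show (0 : ℝ) ∈ Set.Icc _ _ from ⟨not_lt.1 hneg, by rw [h0]; exact zero_le_one⟩)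
  exact hne s hs hs0

/-- The nearest point retraction onto a closed convex set. -/
theorem exists_nearest_point_retraction {K : Set E} (hne : K.Nonempty) (hc : IsClosed K)
    (hK : Convex ℝ K) :
    ∃ r : E → E, LipschitzWith 1 r ∧ (∀ x, r x ∈ K) ∧ (∀ x ∈ K, r x = x) ∧
      ∀ x, ∀ w ∈ K, inner ℝ (x - r x) (w - r x) ≤ 0 := by
  have h : ∀ x : E, ∃ v ∈ K, ∀ w ∈ K, inner ℝ (x - v) (w - v) ≤ 0 := by
    intro x
    obtain ⟨v, hv, hvx⟩ := exists_norm_eq_iInf_of_complete_convex hne hc.isComplete hK x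
    exact ⟨v, hv, (norm_eq_iInf_iff_real_inner_le_zero hK hv).1 hvx⟩
  choose r hr hrin using h
  refine ⟨r, LipschitzWith.of_dist_le_mul fun x y => ?_, hr, fun x hx => ?_, hrin⟩
  · have h1 := hrin x (r y) (hr y)
    have h2 := hrin y (r x) (hr x)
    have h3 : ‖r x - r y‖ ^ 2 ≤ ‖x - y‖ * ‖r x - r y‖ := by
      have h4 : inner ℝ (x - r x) (r y - r x) + inner ℝ (y - r y) (r x - r y) =
          ‖r x - r y‖ ^ 2 - inner ℝ (x - y) (r x - r y) := by
        rw [← real_inner_self_eq_norm_sq]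
        simp only [inner_sub_left, inner_sub_right]
        ring
      have h5 := real_inner_le_norm (x - y) (r x - r y)
      linarith
    rw [dist_eq_norm, dist_eq_norm, NNReal.coe_one, one_mul]
    by_contra hlt
    have hlt := not_le.1 hlt
    nlinarith [norm_nonneg (x - y)]
  · have h1 := hrin x x hx
    rw [real_inner_self_eq_norm_sq] at h1
    have : ‖x - r x‖ = 0 := by nlinarith [norm_nonneg (x - r x)]
    exact (sub_eq_zero.1 (norm_eq_zero.1 this)).symm

/-- From a projection strictly inside the ball one could still move a little towards `x`, against
the variational inequality. -/
theorem norm_nearest_point_closedBall {E : Type*} [NormedAddCommGroup E] [InnerProductSpace ℝ E]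
    {r : E → E}
    (hr : ∀ x, r x ∈ Metric.closedBall (0 : E) 1)
    (hrin : ∀ x, ∀ w ∈ Metric.closedBall (0 : E) 1, inner ℝ (x - r x) (w - r x) ≤ 0)
    {x : E} (hx : 1 ≤ ‖x‖) : ‖r x‖ = 1 := by
  have h1 : ‖r x‖ ≤ 1 := by simpa using hr x
  by_contra hne
  have hlt : ‖r x‖ < 1 := lt_of_le_of_ne h1 hne
  have hpos : 0 < ‖x - r x‖ := by
    rw [norm_pos_iff, sub_ne_zero]
    rintro h
    rw [← h] at hlt
    linarith
  set s := (1 - ‖r x‖) / ‖x - r x‖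
  have hs : 0 < s := div_pos (by linarith) hpos
  have h2 := hrin x (r x + s • (x - r x)) (by
    rw [mem_closedBall_zero_iff]
    refine (norm_add_le _ _).trans ?_
    rw [norm_smul, Real.norm_of_nonneg hs.le, div_mul_cancel₀ _ hpos.ne']
    linarith)
  rw [add_sub_cancel_left, inner_smul_right, real_inner_self_eq_norm_sq] at h2
  have : 0 < s * ‖x - r x‖ ^ 2 := by positivity
  linarith

/-- The integral of a polynomial with parameters is a polynomial, hence constant as soon as it is
so on an interval. -/
theorem integral_polynomial_eval_eq {X : Type*} [MeasurableSpace X] {μ : Measure X}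
    {P : X → Polynomial ℝ} {N : ℕ} (hdeg : ∀ x, (P x).natDegree ≤ N)
    (hint : ∀ t, Integrable (fun x => (P x).eval t) μ) {c ε : ℝ} (hε : 0 < ε)
    (hc : ∀ t, 0 ≤ t → t < ε → ∫ x, (P x).eval t ∂μ = c) (s : ℝ) :
    ∫ x, (P x).eval s ∂μ = c := by
  -- The `N + 1` nodes lie in `[0, ε)`. Lagrange interpolation makes evaluation at `s` a fixed
  -- combination of evaluations at the nodes, with coefficients of sum `1`.
  set node : ℕ → ℝ := fun i => i * (ε / (N + 1)) with hnode
  have hN : (0 : ℝ) < N + 1 := by positivity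
  have hδ : 0 < ε / (N + 1) := by positivity
  have hnode_inj : Set.InjOn node (Finset.range (N + 1)) := by
    intro i _ j _ hij
    have := mul_right_cancel₀ hδ.ne' hij
    exact_mod_cast this
  have hinterp : ∀ Q : Polynomial ℝ, Q.natDegree ≤ N →
      Q.eval s = ∑ i ∈ Finset.range (N + 1),
        Q.eval (node i) * (Lagrange.basis (Finset.range (N + 1)) node i).eval s := by
    intro Q hQ
    have := Lagrange.eq_interpolate hnode_inj (f := Q) (by
      rw [Finset.card_range]
      exact lt_of_le_of_lt Polynomial.degree_le_natDegree (by exact_mod_cast Nat.lt_succ_of_le hQ))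
    conv_lhs => rw [this]
    simp [Lagrange.interpolate_apply, Polynomial.eval_finsetSum]
  have hnodes : ∀ i ∈ Finset.range (N + 1), ∫ x, (P x).eval (node i) ∂μ = c := by
    intro i hi
    have hiN : (i : ℝ) < N + 1 := by exact_mod_cast Finset.mem_range.1 hi
    refine hc _ (by positivity) ?_
    calc (i : ℝ) * (ε / (N + 1)) < (N + 1) * (ε / (N + 1)) := by gcongr
      _ = ε := by field_simp
  simp_rw [fun x => hinterp (P x) (hdeg x)]
  rw [integral_finsetSum _ fun i _ => (hint _).mul_const _]
  simp_rw [integral_mul_const]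
  rw [Finset.sum_congr rfl fun i hi => by rw [hnodes i hi], ← Finset.mul_sum]
  have h2 := hinterp 1 (by simp)
  simp only [Polynomial.eval_one, one_mul] at h2
  rw [← h2, mul_one]

/-- There is no continuously differentiable retraction of the unit ball onto the unit sphere. -/
theorem not_exists_contDiff_retraction_sphere {f : E → E}
    (hf : ∀ x ∈ Metric.closedBall (0 : E) 1, ContDiffAt ℝ 1 f x)
    (hf1 : ∀ x ∈ Metric.closedBall (0 : E) 1, ‖f x‖ = 1)
    (hfix : ∀ x : E, ‖x‖ = 1 → f x = x) : False := by
  borelize E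
  set B := Metric.closedBall (0 : E) 1 with hB
  have hBc : IsCompact B := isCompact_closedBall _ _
  have hBconv : Convex ℝ B := convex_closedBall _ _
  set v : E → E := fun x => f x - x with hv
  have hvd : ∀ x ∈ B, ContDiffAt ℝ 1 v x := fun x hx => (hf x hx).sub contDiffAt_id
  set A : E → E →L[ℝ] E := fun x => fderiv ℝ v x with hAdef
  have hA : ∀ x ∈ B, HasFDerivAt v (A x) x := fun x hx =>
    ((hvd x hx).differentiableAt (by norm_num)).hasFDerivAt
  have hAc : ContinuousOn A B := fun x hx =>
    ((hvd x hx).continuousAt_fderiv (by norm_num)).continuousWithinAt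
  obtain ⟨K, hK⟩ : ∃ K : NNReal, ∀ x ∈ B, ‖A x‖₊ ≤ K := by
    obtain ⟨C, hC⟩ := hBc.exists_bound_of_continuousOn hAc
    refine ⟨C.toNNReal, fun x hx => ?_⟩
    rw [← NNReal.coe_le_coe, coe_nnnorm]
    exact (hC x hx).trans (Real.le_coe_toNNReal C)
  have hvL : LipschitzOnWith K v B :=
    hBconv.lipschitzOnWith_of_nnnorm_fderiv_le (fun x hx => (hA x hx).differentiableAt) hK
  obtain ⟨r, hrL, hrB, hrid, hrin⟩ := exists_nearest_point_retraction (K := B)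
    ⟨0, by simp [hB]⟩ hBc.isClosed hBconv
  -- `u` extends `v` from the ball to a globally Lipschitz field that vanishes outside, as `r` sends
  -- the exterior to the sphere, where `f` is the identity.
  set u : E → E := fun x => v (r x) with hu
  have huL : LipschitzWith K u := by
    have := hvL.comp (hrL.lipschitzOnWith (s := Set.univ)) (fun x _ => hrB x)
    rw [mul_one, lipschitzOnWith_univ] at this
    exact this
  have huout : ∀ x, x ∉ B → u x = 0 := by
    intro x hx
    have h1 : 1 ≤ ‖x‖ := by
      rw [hB, mem_closedBall_zero_iff] at hx
      exact (not_le.1 hx).le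
    simp only [hu, hv]
    rw [hfix _ (norm_nearest_point_closedBall hrB hrin h1), sub_self]
  have huin : ∀ x ∈ B, u x = v x := fun x hx => by simp only [hu, hrid x hx]
  set μ : Measure E := Measure.addHaar
  -- For small `t`, `h = id + t u` is a bijection of `E`. It fixes the exterior and maps the ball
  -- into itself by convexity, hence onto itself: the volume is preserved.
  have hvol : ∀ t : ℝ, 0 ≤ t → t ≤ 1 → t * K < 1 →
      ∫ x in B, (1 + t • A x).det ∂μ = μ.real B := by
    intro t ht0 ht1 htK
    set h : E → E := fun x => x + t • u x with hh
    have happ : ApproximatesLinearOn h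
        ((ContinuousLinearEquiv.refl ℝ E : E ≃L[ℝ] E) : E →L[ℝ] E) Set.univ (t.toNNReal * K) := by
      intro x _ y _
      have : h x - h y - (x - y) = t • (u x - u y) := by
        simp only [hh, smul_sub]; abel
      simp only [ContinuousLinearEquiv.coe_refl, ContinuousLinearMap.id_apply, this]
      rw [norm_smul, Real.norm_of_nonneg ht0, NNReal.coe_mul, Real.coe_toNNReal _ ht0, mul_assoc]
      gcongr
      exact huL.norm_sub_le x y
    have hsmall : Subsingleton E ∨
        t.toNNReal * K < ‖((ContinuousLinearEquiv.refl ℝ E).symm : E →L[ℝ] E)‖₊⁻¹ := by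
      rcases subsingleton_or_nontrivial E with hE | hE
      · exact Or.inl hE
      · right
        rw [← NNReal.coe_lt_coe]
        simpa [Real.coe_toNNReal _ ht0] using htK
    have hinj : Set.InjOn h B := (happ.injOn hsmall).mono (Set.subset_univ B)
    have hsurj : Function.Surjective h := happ.surjective hsmall
    have himg : h '' B = B := by
      apply Set.Subset.antisymm
      · rintro _ ⟨x, hx, rfl⟩
        have : h x = (1 - t) • x + t • f x := by
          simp only [hh, huin x hx, hv, smul_sub, sub_smul, one_smul]; abel
        rw [this]
        exact hBconv hx (by simp [hB, hf1 x hx]) (by linarith) ht0 (by ring)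
      · intro y hy
        obtain ⟨x, rfl⟩ := hsurj y
        by_cases hx : x ∈ B
        · exact ⟨x, hx, rfl⟩
        · have : h x = x := by simp [hh, huout x hx]
          exact absurd (this ▸ hy) hx
    have hder : ∀ x ∈ B, HasFDerivWithinAt h (1 + t • A x) B x := by
      intro x hx
      have h1 : HasFDerivWithinAt (fun x => x + t • v x) (1 + t • A x) B x :=
        ((hasFDerivAt_id x).add ((hA x hx).const_smul t)).hasFDerivWithinAt
      exact h1.congr (fun y hy => by simp only [hh, huin y hy]) (by simp only [hh, huin x hx])
    have hcv := integral_image_eq_integral_abs_det_fderiv_smul μ hBc.measurableSet hder hinj (fun _ => (1 : ℝ))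
    rw [himg] at hcv
    have h1 : ∫ x in B, |(1 + t • A x).det| • (1 : ℝ) ∂μ = ∫ x in B, (1 + t • A x).det ∂μ := by
      refine setIntegral_congr_fun hBc.measurableSet fun x hx => ?_
      have hpos := det_one_add_smul_pos (A x) ht0 (lt_of_le_of_lt
        (mul_le_mul_of_nonneg_left (show ‖A x‖ ≤ K from hK x hx) ht0) htK)
      simp only [smul_eq_mul, mul_one, abs_of_pos hpos]
    rw [← h1, ← hcv]
    simp
  -- As `‖f‖ = 1` on the ball, the range of the derivative is orthogonal to `f x ≠ 0`.
  have hdet1 : ∀ x ∈ B, (1 + (1 : ℝ) • A x).det = 0 := by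
    intro x hx
    set D : E →L[ℝ] E := 1 + (1 : ℝ) • A x with hD
    have hdf : HasFDerivAt f D x := by
      have := (hasFDerivAt_id x).add ((hA x hx).const_smul (1 : ℝ))
      refine (this.congr_of_eventuallyEq (Eventually.of_forall fun y => ?_))
      simp [hv]
    have hconst : HasFDerivWithinAt (fun y => inner ℝ (f y) (f y)) (0 : E →L[ℝ] ℝ) B x := by
      refine (hasFDerivWithinAt_const (1 : ℝ) x B).congr (fun y hy => ?_) ?_
      · rw [real_inner_self_eq_norm_sq, hf1 y hy, one_pow]
      · rw [real_inner_self_eq_norm_sq, hf1 x hx, one_pow]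
    have huniq : UniqueDiffWithinAt ℝ B x :=
      uniqueDiffOn_convex hBconv ⟨0, by
        rw [mem_interior_iff_mem_nhds]; exact Metric.closedBall_mem_nhds _ one_pos⟩ x hx
    have hzero := huniq.eq (hdf.hasFDerivWithinAt.inner ℝ hdf.hasFDerivWithinAt) hconst
    have horth : ∀ y, inner ℝ (f x) (D y) = 0 := by
      intro y
      have h1 := DFunLike.congr_fun hzero y
      simp only [ContinuousLinearMap.comp_apply, ContinuousLinearMap.prod_apply,
        fderivInnerCLM_apply, zero_apply] at h1
      rw [real_inner_comm (f x) (D y)] at h1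
      linarith
    by_contra hne
    obtain ⟨y, hy⟩ := (LinearMap.equivOfDetNeZero (D : E →ₗ[ℝ] E) hne).surjective (f x)
    have hy' : D y = f x := hy
    have h2 := horth y
    rw [hy', real_inner_self_eq_norm_sq, hf1 x hx] at h2
    norm_num at h2
  choose P hPdeg hP using fun x => exists_polynomial_det_one_add_smul (A x)
  -- The integral is polynomial in `t` and constant near `0`, hence constant up to `t = 1`, where it
  -- vanishes; but the ball has positive volume.
  have hfinal : ∫ x in B, (1 + (1 : ℝ) • A x).det ∂μ = μ.real B := by
    simp_rw [← hP]
    refine integral_polynomial_eval_eq (ε := 1 / (K + 1)) hPdeg (fun t => ?_) (by positivity)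
      (fun t ht0 ht => ?_) 1
    · simp_rw [hP]
      have h1 : ContinuousOn (fun x => 1 + t • A x) B := continuousOn_const.add (hAc.const_smul t)
      have h2 : ContinuousOn (fun x => (1 + t • A x).det) B :=
        ContinuousLinearMap.continuous_det.comp_continuousOn h1
      exact h2.integrableOn_compact hBc
    · simp_rw [hP]
      have hK0 : (0 : ℝ) ≤ K := K.2
      rw [lt_div_iff₀ (by positivity)] at ht
      exact hvol t ht0 (by nlinarith) (by nlinarith)
  rw [setIntegral_congr_fun hBc.measurableSet hdet1] at hfinal
  have hpos : 0 < μ.real B := by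
    refine ENNReal.toReal_pos (Metric.measure_closedBall_pos μ 0 one_pos).ne'
      hBc.measure_lt_top.ne
  simp at hfinal
  linarith

/-- Without a fixed point, follow the ray from `g x` through `x` to the sphere: this is a
retraction. The coefficient of `w x` is the larger root of a quadratic with quarter discriminant `d
x`. Since `d > 0` the root is smooth; on the sphere `q > 0`, so it is `0`. -/
theorem exists_fixed_point_of_contDiff {g : E → E} (hg : ContDiff ℝ 1 g)
    (hg1 : ∀ x ∈ Metric.closedBall (0 : E) 1, ‖g x‖ < 1) :
    ∃ x ∈ Metric.closedBall (0 : E) 1, g x = x := by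
  by_contra! hne
  set w : E → E := fun x => x - g x with hw
  have hwd : ContDiff ℝ 1 w := contDiff_id.sub hg
  set q : E → ℝ := fun x => inner ℝ x (w x) with hq
  have hqd : ContDiff ℝ 1 q := contDiff_id.inner ℝ hwd
  set d : E → ℝ := fun x => q x ^ 2 + ‖w x‖ ^ 2 * (1 - ‖x‖ ^ 2) with hd
  have hdd : ContDiff ℝ 1 d :=
    (hqd.pow 2).add ((hwd.norm_sq ℝ).mul (contDiff_const.sub (contDiff_id.norm_sq ℝ)))
  have hwpos : ∀ x ∈ Metric.closedBall (0 : E) 1, 0 < ‖w x‖ := fun x hx =>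
    norm_pos_iff.2 (sub_ne_zero.2 (hne x hx).symm)
  have hqpos : ∀ x : E, ‖x‖ = 1 → 0 < q x := by
    intro x hx
    have h1 := real_inner_le_norm x (g x)
    have h2 := hg1 x (by simp [hx])
    simp only [hq, hw, inner_sub_right, real_inner_self_eq_norm_sq]
    rw [hx] at h1 ⊢
    linarith
  have hdpos : ∀ x ∈ Metric.closedBall (0 : E) 1, 0 < d x := by
    intro x hx
    have hx1 : ‖x‖ ≤ 1 := by simpa using hx
    have := hwpos x hx
    rcases hx1.lt_or_eq with h | h
    · have : 0 < 1 - ‖x‖ ^ 2 := by nlinarith [norm_nonneg x]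
      simp only [hd]
      positivity
    · have := hqpos x h
      simp only [hd, h]
      nlinarith
  refine not_exists_contDiff_retraction_sphere
    (f := fun x => x + ((-q x + √(d x)) / ‖w x‖ ^ 2) • w x) (fun x hx => ?_) (fun x hx => ?_)
    (fun x hx => ?_)
  · exact contDiffAt_id.add (((hqd.neg.contDiffAt.add
      (hdd.contDiffAt.sqrt (hdpos x hx).ne')).div (hwd.norm_sq ℝ).contDiffAt
      (by have := hwpos x hx; positivity)).smul hwd.contDiffAt)
  · have hwx := hwpos x hx
    have hsq := Real.sq_sqrt (hdpos x hx).le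
    have h1 : ‖x + ((-q x + √(d x)) / ‖w x‖ ^ 2) • w x‖ ^ 2 = 1 := by
      rw [norm_add_sq_real, inner_smul_right, norm_smul, mul_pow, Real.norm_eq_abs, sq_abs]
      change ‖x‖ ^ 2 + 2 * ((-q x + √(d x)) / ‖w x‖ ^ 2 * q x) + _ = 1
      field_simp
      have : √(d x) ^ 2 = q x ^ 2 + ‖w x‖ ^ 2 * (1 - ‖x‖ ^ 2) := hsq
      linear_combination this
    exact (pow_eq_one_iff_of_nonneg (norm_nonneg _) two_ne_zero).1 h1
  · have : d x = q x ^ 2 := by simp [hd, hx]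
    simp [this, Real.sqrt_sq (hqpos x hx).le]

/-- **Brouwer's fixed point theorem**, for maps into the open ball. -/
theorem exists_fixed_point_of_continuous {g : E → E} (hg : Continuous g)
    (hg1 : ∀ x ∈ Metric.closedBall (0 : E) 1, ‖g x‖ < 1) :
    ∃ x ∈ Metric.closedBall (0 : E) 1, g x = x := by
  by_contra! hne
  have hBc : IsCompact (Metric.closedBall (0 : E) 1) := isCompact_closedBall _ _
  have hBne : (Metric.closedBall (0 : E) 1).Nonempty := ⟨0, by simp⟩
  obtain ⟨a, ha, hamin⟩ := hBc.exists_isMinOn hBne (f := fun x => ‖g x - x‖) (by fun_prop)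
  obtain ⟨b, hb, hbmax⟩ := hBc.exists_isMaxOn hBne (f := fun x => ‖g x‖) (by fun_prop)
  -- An `ε`-approximation still maps into the open ball and still has no fixed point.
  set ε := min ‖g a - a‖ (1 - ‖g b‖) with hε
  have hε0 : 0 < ε :=
    lt_min (norm_pos_iff.2 (sub_ne_zero.2 (hne a ha))) (by linarith [hg1 b hb])
  obtain ⟨f, hf, hfg, -⟩ := hg.exists_contDiff_approx 1 (ε := fun _ => ε) continuous_const
    fun _ => hε0
  obtain ⟨x, hx, hfx⟩ := exists_fixed_point_of_contDiff (g := f) hf fun x hx => by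
    have h1 := hfg x
    rw [dist_eq_norm] at h1
    have h2 : ‖g x‖ ≤ ‖g b‖ := hbmax hx
    have h3 : ‖f x‖ ≤ ‖f x - g x‖ + ‖g x‖ := by simpa using norm_add_le (f x - g x) (g x)
    linarith [min_le_right ‖g a - a‖ (1 - ‖g b‖)]
  have h1 := hfg x
  rw [hfx, dist_comm, dist_eq_norm] at h1
  have h2 : ‖g a - a‖ ≤ ‖g x - x‖ := hamin hx
  linarith [min_le_left ‖g a - a‖ (1 - ‖g b‖)]

/-- The **Hartman–Stampacchia theorem**: a continuous vector field on a compact convex set solves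
a variational inequality. -/
theorem exists_forall_inner_sub_le_zero {K : Set E} (hne : K.Nonempty) (hK : IsCompact K)
    (hconv : Convex ℝ K) {F : E → E} (hF : ContinuousOn F K) :
    ∃ p ∈ K, ∀ q ∈ K, inner ℝ (F p) (q - p) ≤ 0 := by
  obtain ⟨r, hrL, hrK, hrid, hrin⟩ := exists_nearest_point_retraction hne hK.isClosed hconv
  have hrc : Continuous r := hrL.continuous
  obtain ⟨C, hC⟩ := hK.isBounded.exists_norm_le
  set R : ℝ := |C| + 1 with hR
  have hR0 : 0 < R := by positivity
  have hFr : Continuous fun x => F (r x) := hF.comp_continuous hrc hrK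
  -- A fixed point of `p ↦ r (p + F p)` is a solution, by the inequality for the projection. Scaling
  -- by `R` puts `K` inside the open unit ball; the inner `r` is there because `F` is continuous
  -- only on `K`.
  obtain ⟨x, -, hx⟩ := exists_fixed_point_of_continuous
    (g := fun x => R⁻¹ • r (r (R • x) + F (r (R • x))))
    (((hrc.comp (hrc.add hFr)).comp (continuous_const_smul R)).const_smul R⁻¹) fun x _ => by
      rw [norm_smul, norm_inv, Real.norm_of_nonneg hR0.le, inv_mul_lt_iff₀ hR0, mul_one]
      exact lt_of_le_of_lt (hC _ (hrK _)) (by linarith [le_abs_self C])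
  set p := r (R • x) with hp
  have hpx : r (p + F p) = R • x := by
    rw [← hx, smul_inv_smul₀ hR0.ne']
  have hpK : p ∈ K := hrK _
  have hfix : r (p + F p) = p := by
    rw [hpx, hp, ← hpx, hrid _ (hrK _)]
  refine ⟨p, hpK, fun q hq => ?_⟩
  have := hrin (p + F p) q hq
  rwa [hfix, add_sub_cancel_left] at this

end Brouwer

/-! ### Defensive forecasting. -/

section Forecasting

variable {Ω : Type*} [Fintype Ω]

/-- A vector field on the interior of the simplex that is orthogonal to the position is
approximately nonpositive somewhere. -/
theorem exists_pos_forall_le_one [Nonempty Ω] {F : stdSimplex ℝ Ω → Ω → ℝ} {C : ℝ}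
    (hF : ContinuousOn F {p | ∀ a, 0 < p a}) (hC : ∀ p a, |F p a| ≤ C)
    (horth : ∀ p : stdSimplex ℝ Ω, (∀ a, 0 < p a) → ∑ a, p a * F p a = 0) :
    ∃ p : stdSimplex ℝ Ω, (∀ a, 0 < p a) ∧ ∀ a, F p a ≤ 1 := by
  classical
  set k : ℝ := (Fintype.card Ω : ℝ) with hk
  have hk0 : 0 < k := by simp [hk, Fintype.card_pos]
  set D : ℝ := max C 1 with hD
  have hD0 : 0 < D := lt_of_lt_of_le one_pos (le_max_right _ _)
  -- With this `δ`, testing the inequality at the vertex `a` of `{p | ∀ b, δ ≤ p b}` gives `(1 - k *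
  -- δ) * F p a ≤ k * δ * D`, which is exactly `F p a ≤ 1`.
  set δ : ℝ := 1 / (k * (D + 1)) with hδ
  have hδ0 : 0 < δ := by positivity
  have hkδ : k * δ = 1 / (D + 1) := by rw [hδ]; field_simp
  have hkδ1 : 1 - k * δ = D / (D + 1) := by rw [hkδ]; field_simp; ring
  set K : Set (EuclideanSpace ℝ Ω) := {x | (∀ a, δ ≤ x a) ∧ ∑ a, x a = 1} with hKdef
  have hKsub : ∀ x ∈ K, WithLp.ofLp x ∈ stdSimplex ℝ Ω := fun x hx =>
    ⟨fun a => hδ0.le.trans (hx.1 a), hx.2⟩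
  have hKpt : ∀ a : Ω, WithLp.toLp 2 (fun b => δ + if b = a then 1 - k * δ else 0) ∈ K := by
    intro a
    refine ⟨fun b => ?_, ?_⟩
    · have : 0 ≤ 1 - k * δ := by rw [hkδ1]; positivity
      simp only
      split_ifs <;> linarith
    · simp [Finset.sum_add_distrib, ← hk]
  have hKconv : Convex ℝ K := by
    intro x hx y hy s t hs ht hst
    refine ⟨fun a => ?_, ?_⟩
    · simp only [PiLp.add_apply, PiLp.smul_apply, smul_eq_mul]
      nlinarith [hx.1 a, hy.1 a]
    · simp only [PiLp.add_apply, PiLp.smul_apply, smul_eq_mul, Finset.sum_add_distrib,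
        ← Finset.mul_sum, hx.2, hy.2]
      linarith
  have hKcomp : IsCompact K := by
    have hcl : IsClosed K := by
      have : K = (⋂ a, {x : EuclideanSpace ℝ Ω | δ ≤ x a}) ∩ {x | ∑ a, x a = 1} := by
        ext x
        simp [hKdef]
      rw [this]
      exact (isClosed_iInter fun a => isClosed_le continuous_const (by fun_prop)).inter
        (isClosed_eq (by fun_prop) continuous_const)
    have himg : IsCompact (WithLp.toLp 2 '' stdSimplex ℝ Ω : Set (EuclideanSpace ℝ Ω)) :=
      (isCompact_stdSimplex ℝ Ω).image (PiLp.continuous_toLp 2 _)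
    exact himg.of_isClosed_subset hcl fun x hx => ⟨WithLp.ofLp x, hKsub x hx, rfl⟩
  set G : EuclideanSpace ℝ Ω → EuclideanSpace ℝ Ω := fun x =>
    if h : WithLp.ofLp x ∈ stdSimplex ℝ Ω then WithLp.toLp 2 (F ⟨WithLp.ofLp x, h⟩) else 0 with hG
  have hGK : ∀ x (hx : x ∈ K), G x = WithLp.toLp 2 (F ⟨WithLp.ofLp x, hKsub x hx⟩) :=
    fun x hx => dif_pos (hKsub x hx)
  have hGc : ContinuousOn G K := by
    rw [continuousOn_iff_continuous_domRestrict]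
    have h1 : K.domRestrict G =
        fun x : K => WithLp.toLp 2 (F ⟨WithLp.ofLp x.1, hKsub x.1 x.2⟩) :=
      funext fun x => hGK x.1 x.2
    rw [h1]
    refine (PiLp.continuous_toLp 2 _).comp (hF.comp_continuous ?_ fun x a => ?_)
    · exact ((PiLp.continuous_ofLp 2 _).comp continuous_subtype_val).subtype_mk _
    · exact hδ0.trans_le (x.2.1 a)
  obtain ⟨x, hx, hvi⟩ := exists_forall_inner_sub_le_zero
    (Set.nonempty_of_mem (hKpt (Classical.arbitrary Ω))) hKcomp hKconv hGc
  set p : stdSimplex ℝ Ω := ⟨WithLp.ofLp x, hKsub x hx⟩ with hp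
  have hppos : ∀ a, 0 < p a := fun a => hδ0.trans_le (hx.1 a)
  refine ⟨p, hppos, fun a => ?_⟩
  have h1 := hvi _ (hKpt a)
  have h2 : ∑ b, F p b * x b = 0 := by
    rw [← horth p hppos]
    exact Finset.sum_congr rfl fun b _ => mul_comm _ _
  rw [inner_sub_right, hGK x hx] at h1
  simp only [PiLp.inner_apply, RCLike.inner_apply, conj_trivial] at h1
  have h3 : ∑ b, x b * F p b = 0 := by rw [← h2]; simp_rw [mul_comm]
  have h4 : ∑ b, (δ + if b = a then 1 - k * δ else 0) * F p b =
      δ * ∑ b, F p b + (1 - k * δ) * F p a := by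
    simp [add_mul, Finset.sum_add_distrib, Finset.mul_sum]
  have h5 : -(k * D) ≤ ∑ b, F p b := by
    have : ∑ b : Ω, (-D) ≤ ∑ b, F p b := Finset.sum_le_sum fun b _ => by
      have := (abs_le.1 (hC p b)).1
      linarith [le_max_left C 1]
    simpa [← hk] using this
  have h6 : δ * ∑ b, F p b + (1 - k * δ) * F p a ≤ 0 := by
    rw [← h4]
    change ∑ b, _ - ∑ b, x b * F p b ≤ 0 at h1
    rw [h3, sub_zero] at h1
    exact h1
  have h7 : (1 - k * δ) * F p a ≤ k * δ * D := by nlinarith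
  rw [hkδ1, hkδ] at h7
  have h8 : D / (D + 1) * F p a ≤ D / (D + 1) * 1 := by
    refine h7.trans (le_of_eq ?_)
    ring
  exact le_of_mul_le_mul_left h8 (by positivity)

variable {I : Type*}

/-- The sum of the features `X` along a finite history. -/
noncomputable def cumulativeFeature (X : ForecastHistory Ω → stdSimplex ℝ Ω → I → Ω → ℝ)
    (h : ForecastHistory Ω) (i : I) : ℝ :=
  -- The default `0` is never reached, since `m < h.length`.
  ∑ m ∈ Finset.range h.length, (h[m]?).elim 0 fun e => X (h.take m) e.1 i e.2

theorem cumulativeFeature_append (X : ForecastHistory Ω → stdSimplex ℝ Ω → I → Ω → ℝ)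
    (h : ForecastHistory Ω) (p : stdSimplex ℝ Ω) (a : Ω) (i : I) :
    cumulativeFeature X (h ++ [(p, a)]) i = cumulativeFeature X h i + X h p i a := by
  unfold cumulativeFeature
  rw [List.length_append, List.length_singleton, Finset.sum_range_succ]
  congr 1
  · refine Finset.sum_congr rfl fun m hm => ?_
    have hm := Finset.mem_range.1 hm
    rw [List.getElem?_append_left hm, List.take_append_of_le_length hm.le]
  · simp

theorem cumulativeFeature_playHistory (X : ForecastHistory Ω → stdSimplex ℝ Ω → I → Ω → ℝ)
    (σ : DetForecaster Ω) (ω : ℕ → Ω) (n : ℕ) (i : I) :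
    cumulativeFeature X (playHistory σ ω n) i =
      ∑ m ∈ Finset.range n, X (playHistory σ ω m) (prediction σ ω m) i (ω m) := by
  induction n with
  | zero => simp [cumulativeFeature, playHistory]
  | succ n ih =>
    rw [playHistory, cumulativeFeature_append, ih, Finset.sum_range_succ]
    rfl

theorem abs_cumulativeFeature_le {X : ForecastHistory Ω → stdSimplex ℝ Ω → I → Ω → ℝ}
    (hb : ∀ h p i a, |X h p i a| ≤ 1) (h : ForecastHistory Ω) (i : I) :
    |cumulativeFeature X h i| ≤ h.length := by
  refine (Finset.abs_sum_le_sum_abs _ _).trans ?_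
  refine (Finset.sum_le_sum (g := fun _ => (1 : ℝ)) fun m _ => ?_).trans (by simp)
  cases h[m]? with
  | none => simp
  | some e => exact hb _ _ _ _

theorem measurable_cumulativeFeature [MeasurableSpace I]
    {X : ForecastHistory Ω → stdSimplex ℝ Ω → I → Ω → ℝ}
    (hm : ∀ h p a, Measurable fun i => X h p i a) (h : ForecastHistory Ω) :
    Measurable (cumulativeFeature X h) := by
  refine Finset.measurable_fun_sum _ fun m _ => ?_
  cases h[m]? with
  | none => exact measurable_const
  | some e => exact hm _ _ _

/-- Defensive forecasting: a deterministic forecaster keeps the mean square of a family of fair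
features of linear order, against every sequence of outcomes. -/
theorem exists_forecaster_integral_sq_le [Nonempty Ω] [MeasurableSpace I] (ν : Measure I)
    [IsFiniteMeasure ν] (X : ForecastHistory Ω → stdSimplex ℝ Ω → I → Ω → ℝ)
    (hm : ∀ h p a, Measurable fun i => X h p i a) (hb : ∀ h p i a, |X h p i a| ≤ 1)
    (hcont : ∀ h i a, ContinuousOn (fun p => X h p i a) {p | ∀ a, 0 < p a})
    (hfair : ∀ h (p : stdSimplex ℝ Ω) i, (∀ a, 0 < p a) → ∑ a, p a * X h p i a = 0) :
    ∃ σ : DetForecaster Ω, (∀ h a, 0 < σ h a) ∧ ∀ (ω : ℕ → Ω) (n : ℕ),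
      ∫ i, cumulativeFeature X (playHistory σ ω n) i ^ 2 ∂ν ≤ (2 + ν.real Set.univ) * n := by
  have hSm := measurable_cumulativeFeature hm
  have hSb := abs_cumulativeFeature_le hb
  have hSX : ∀ h p i a, ‖cumulativeFeature X h i * X h p i a‖ ≤ h.length := by
    intro h p i a
    rw [norm_mul, Real.norm_eq_abs, Real.norm_eq_abs]
    exact (mul_le_mul (hSb h i) (hb h p i a) (abs_nonneg _) (Nat.cast_nonneg _)).trans
      (mul_one _).le
  have hSXint : ∀ h p a, Integrable (fun i => cumulativeFeature X h i * X h p i a) ν :=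
    fun h p a => Integrable.of_bound ((hSm h).mul (hm h p a)).aestronglyMeasurable h.length
      (Eventually.of_forall fun i => hSX h p i a)
  have hstep : ∀ h : ForecastHistory Ω, ∃ p : stdSimplex ℝ Ω, (∀ a, 0 < p a) ∧
      ∀ a, ∫ i, cumulativeFeature X h i * X h p i a ∂ν ≤ 1 := by
    intro h
    refine exists_pos_forall_le_one (C := h.length * ν.real Set.univ)
      (F := fun p a => ∫ i, cumulativeFeature X h i * X h p i a ∂ν) ?_ (fun p a => ?_)
      fun p hp => ?_
    · refine continuousOn_pi.2 fun a => continuousOn_of_dominated (bound := fun _ => h.length)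
        (fun p _ => (hSXint h p a).aestronglyMeasurable)
        (fun p _ => Eventually.of_forall fun i => hSX h p i a) (integrable_const _)
        (Eventually.of_forall fun i => continuousOn_const.mul (hcont h i a))
    · exact norm_integral_le_of_norm_le_const (Eventually.of_forall fun i => hSX h p i a)
    · simp_rw [← integral_const_mul]
      rw [← integral_finsetSum _ fun a _ => (hSXint h p a).const_mul _]
      have : ∀ i, ∑ a, p a * (cumulativeFeature X h i * X h p i a) = 0 := by
        intro i
        rw [← mul_zero (cumulativeFeature X h i), ← hfair h p i hp, Finset.mul_sum]
        exact Finset.sum_congr rfl fun a _ => by ring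
      simp [this]
  choose σ hσpos hσ using hstep
  refine ⟨σ, hσpos, fun ω n => ?_⟩
  induction n with
  | zero => simp [cumulativeFeature, playHistory]
  | succ n ih =>
    set h := playHistory σ ω n
    simp_rw [playHistory, cumulativeFeature_append]
    change ∫ i, (cumulativeFeature X h i + X h (σ h) i (ω n)) ^ 2 ∂ν ≤ _
    have hsqint : Integrable (fun i => cumulativeFeature X h i ^ 2) ν := by
      refine Integrable.of_bound ((hSm h).pow_const 2).aestronglyMeasurable ((h.length : ℝ) ^ 2)
        (Eventually.of_forall fun i => ?_)
      rw [norm_pow, Real.norm_eq_abs]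
      exact pow_le_pow_left₀ (abs_nonneg _) (hSb h i) 2
    have hcross : Integrable
        (fun i => 2 * (cumulativeFeature X h i * X h (σ h) i (ω n))) ν :=
      (hSXint h _ _).const_mul 2
    have hadd : Integrable (fun i => cumulativeFeature X h i ^ 2 +
        2 * (cumulativeFeature X h i * X h (σ h) i (ω n))) ν := hsqint.add hcross
    -- In the expanded square, the cross term adds at most `2` by the choice of `σ h`, and the last
    -- square at most `ν.real univ`.
    have hle : ∫ i, (cumulativeFeature X h i + X h (σ h) i (ω n)) ^ 2 ∂ν ≤
        ∫ i, (cumulativeFeature X h i ^ 2 +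
          2 * (cumulativeFeature X h i * X h (σ h) i (ω n)) + 1) ∂ν := by
      refine integral_mono_of_nonneg (Eventually.of_forall fun i => sq_nonneg _)
        (hadd.add (integrable_const 1))
        (Eventually.of_forall fun i => ?_)
      have : X h (σ h) i (ω n) ^ 2 ≤ 1 := (sq_le_one_iff_abs_le_one _).2 (hb _ _ _ _)
      simp only
      nlinarith
    refine hle.trans ?_
    rw [integral_add hadd (integrable_const 1), integral_add hsqint hcross, integral_const_mul]
    have h1 := hσ h (ω n)
    simp only [integral_const, smul_eq_mul, mul_one]
    push_cast
    linarith

end Forecasting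

/-! ### Strong law and approximation of test functions. -/

section Limits

/-- Between `k ^ 2` and the next square `t` moves by at most `2 * k`, negligible against `k ^ 2`. -/
theorem tendsto_div_of_tendsto_div_sq {t : ℕ → ℝ} (hinc : ∀ n, |t (n + 1) - t n| ≤ 1)
    (ht : Tendsto (fun k : ℕ => t (k ^ 2) / (k : ℝ) ^ 2) atTop (𝓝 0)) :
    Tendsto (fun n : ℕ => t n / n) atTop (𝓝 0) := by
  have hgap : ∀ m d : ℕ, |t (m + d) - t m| ≤ d := by
    intro m d
    induction d with
    | zero => simp
    | succ d ih =>
      have h1 := hinc (m + d)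
      have h2 := abs_add_le (t (m + d + 1) - t (m + d)) (t (m + d) - t m)
      rw [sub_add_sub_cancel] at h2
      rw [← add_assoc]
      push_cast
      linarith
  have hsqrt : Tendsto Nat.sqrt atTop atTop :=
    tendsto_atTop.2 fun b => by
      filter_upwards [eventually_ge_atTop (b ^ 2)] with n hn
      exact Nat.le_sqrt'.2 hn
  have hbound : Tendsto (fun k : ℕ => |t (k ^ 2) / (k : ℝ) ^ 2| + 2 / (k : ℝ)) atTop (𝓝 0) := by
    simpa using ht.abs.add (tendsto_const_div_atTop_nhds_zero_nat (2 : ℝ))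
  refine squeeze_zero_norm' ?_ (hbound.comp hsqrt)
  filter_upwards [eventually_ge_atTop 1] with n hn
  set k := Nat.sqrt n with hk
  have hk1 : 1 ≤ k := Nat.le_sqrt'.2 (by simpa using hn)
  have hkn : k ^ 2 ≤ n := Nat.sqrt_le' n
  have hnk : n ≤ k ^ 2 + 2 * k := by
    have := Nat.lt_succ_sqrt' n
    rw [Nat.succ_eq_add_one, ← hk] at this
    nlinarith
  have hk0 : (0 : ℝ) < k := by exact_mod_cast hk1
  have h1 : |t n| ≤ |t (k ^ 2)| + 2 * k := by
    have h2 := abs_add_le (t n - t (k ^ 2)) (t (k ^ 2))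
    rw [sub_add_cancel] at h2
    have h3 := hgap (k ^ 2) (n - k ^ 2)
    rw [Nat.add_sub_cancel' hkn] at h3
    have h4 : ((n - k ^ 2 : ℕ) : ℝ) ≤ 2 * k := by exact_mod_cast (by omega : n - k ^ 2 ≤ 2 * k)
    linarith
  have h3 : (k : ℝ) ^ 2 ≤ n := by exact_mod_cast hkn
  simp only [Function.comp, ← hk]
  rw [Real.norm_eq_abs, abs_div, abs_div, Nat.abs_cast, abs_of_pos (by positivity : (0 : ℝ) < k ^ 2)]
  calc |t n| / (n : ℝ) ≤ (|t (k ^ 2)| + 2 * k) / (k : ℝ) ^ 2 := by gcongr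
    _ = _ := by field_simp

/-- A strong law of large numbers: bounded increments and second moments of linear order. -/
theorem ae_tendsto_div_of_integral_sq_le {Z : Type*} [MeasurableSpace Z] {P : Measure Z}
    [IsFiniteMeasure P] {T : ℕ → Z → ℝ} (hT : ∀ n, Measurable (T n))
    (hb : ∀ n z, |T n z| ≤ n) (hinc : ∀ n z, |T (n + 1) z - T n z| ≤ 1) {C : ℝ}
    (hC : ∀ n : ℕ, ∫ z, T n z ^ 2 ∂P ≤ C * n) :
    ∀ᵐ z ∂P, Tendsto (fun n : ℕ => T n z / n) atTop (𝓝 0) := by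
  -- Along the squares the normalized second moments are at most `C / k ^ 2`, hence summable, so `∑
  -- f k` is finite almost everywhere. No independence is needed.
  set f : ℕ → Z → ℝ := fun k z => (T (k ^ 2) z / (k : ℝ) ^ 2) ^ 2 with hf
  have hfm : ∀ k, Measurable (f k) := fun k => ((hT _).div_const _).pow_const 2
  have hle : ∀ k, ∫⁻ z, ENNReal.ofReal (f k z) ∂P ≤ ENNReal.ofReal (C * (1 / (k : ℝ) ^ 2)) := by
    intro k
    have hint : Integrable (fun z => T (k ^ 2) z ^ 2) P := by
      refine Integrable.of_bound ((hT _).pow_const 2).aestronglyMeasurable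
        (((k ^ 2 : ℕ) : ℝ) ^ 2) (Eventually.of_forall fun z => ?_)
      rw [norm_pow, Real.norm_eq_abs]
      exact pow_le_pow_left₀ (abs_nonneg _) (hb _ z) 2
    simp only [hf, div_pow]
    rw [← ofReal_integral_eq_lintegral_ofReal (hint.div_const _)
      (Eventually.of_forall fun z => by positivity)]
    refine ENNReal.ofReal_le_ofReal ?_
    rw [integral_div]
    rcases Nat.eq_zero_or_pos k with rfl | hk
    · simp
    · have hk0 : (0 : ℝ) < k := by exact_mod_cast hk
      rw [div_le_iff₀ (by positivity)]
      refine (hC (k ^ 2)).trans (le_of_eq ?_)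
      push_cast
      field_simp
  have hsum : ∫⁻ z, ∑' k, ENNReal.ofReal (f k z) ∂P ≠ ⊤ := by
    rw [lintegral_tsum fun k => (hfm k).ennreal_ofReal.aemeasurable]
    refine ne_top_of_le_ne_top ?_ (ENNReal.tsum_le_tsum hle)
    exact ((Real.summable_one_div_nat_pow.2 one_lt_two).mul_left C).tsum_ofReal_ne_top
  have hae := ae_lt_top (Measurable.tsum fun k => (hfm k).ennreal_ofReal) hsum
  filter_upwards [hae] with z hz
  have h1 := ENNReal.tendsto_atTop_zero_of_tsum_ne_top hz.ne
  have h2 : Tendsto (fun k => f k z) atTop (𝓝 0) := by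
    have := (ENNReal.tendsto_toReal ENNReal.zero_ne_top).comp h1
    refine this.congr fun k => ?_
    exact ENNReal.toReal_ofReal (sq_nonneg _)
  refine tendsto_div_of_tendsto_div_sq (fun n => hinc n z) ?_
  rw [tendsto_zero_iff_abs_tendsto_zero]
  have h3 := h2.sqrt
  rw [Real.sqrt_zero] at h3
  exact h3.congr fun k => Real.sqrt_sq_eq_abs _

/-- The continuous functions on a compact metric space can be approximated by multiples of the
members of one sequence of functions bounded by `1`. -/
theorem exists_bounded_seq_approx (Y : Type*) [MetricSpace Y] [CompactSpace Y] :
    ∃ g : ℕ → C(Y, ℝ), (∀ j p, |g j p| ≤ 1) ∧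
      ∀ f : Y → ℝ, Continuous f → ∀ ε > 0, ∃ j, ∃ C : ℝ, ∀ p, |f p - C * g j p| ≤ ε := by
  set d := TopologicalSpace.denseSeq C(Y, ℝ)
  have hpos : ∀ j, 0 < 1 + ‖d j‖ := fun j => by positivity
  refine ⟨fun j => (1 + ‖d j‖)⁻¹ • d j, fun j p => ?_, fun f hf ε hε => ?_⟩
  · have h1 : |d j p| ≤ ‖d j‖ := (d j).norm_coe_le_norm p
    rw [ContinuousMap.smul_apply, smul_eq_mul, abs_mul, abs_of_pos (inv_pos.2 (hpos j)),
      inv_mul_le_iff₀ (hpos j)]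
    linarith
  · obtain ⟨j, hj⟩ := (TopologicalSpace.denseRange_denseSeq C(Y, ℝ)).exists_dist_lt
      (⟨f, hf⟩ : C(Y, ℝ)) hε
    refine ⟨j, 1 + ‖d j‖, fun p => ?_⟩
    rw [ContinuousMap.smul_apply, smul_eq_mul, mul_inv_cancel_left₀ (hpos j).ne']
    exact (ContinuousMap.dist_apply_le_dist p).trans hj.le

end Limits

/-! ### Checking rules as features, and the calibrated forecaster. -/

section Checking

variable {Ω : Type*} [Fintype Ω]

theorem eventProb_nonneg (p : stdSimplex ℝ Ω) (A : Set Ω) : 0 ≤ eventProb p A :=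
  Finset.sum_nonneg fun a _ => Set.indicator_nonneg (fun b _ => p.2.1 b) a

theorem eventProb_mono (p : stdSimplex ℝ Ω) {A B : Set Ω} (h : A ⊆ B) :
    eventProb p A ≤ eventProb p B :=
  Finset.sum_le_sum fun a _ => Set.indicator_le_indicator_of_subset h (fun b => p.2.1 b) a

theorem eventProb_pos {p : stdSimplex ℝ Ω} (hp : ∀ a, 0 < p a) {A : Set Ω} {a : Ω} (ha : a ∈ A) :
    0 < eventProb p A := by
  refine Finset.sum_pos' (fun b _ => Set.indicator_nonneg (fun c _ => p.2.1 c) b)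
    ⟨a, Finset.mem_univ a, ?_⟩
  rw [Set.indicator_of_mem ha]
  exact hp a

/-- This holds also when `eventProb p B = 0`, since the quotient is then `0`. -/
theorem condEventProb_mem_Icc (p : stdSimplex ℝ Ω) (A B : Set Ω) :
    condEventProb p A B ∈ Set.Icc (0 : ℝ) 1 :=
  ⟨div_nonneg (eventProb_nonneg _ _) (eventProb_nonneg _ _),
    div_le_one_of_le₀ (eventProb_mono p Set.inter_subset_right) (eventProb_nonneg _ _)⟩

theorem continuous_eventProb (A : Set Ω) :
    Continuous fun p : stdSimplex ℝ Ω => eventProb p A := by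
  classical
  refine continuous_finsetSum _ fun a _ => ?_
  by_cases ha : a ∈ A
  · simp only [Set.indicator_of_mem ha]
    exact (continuous_apply a).comp continuous_subtype_val
  · simp only [Set.indicator_of_notMem ha]
    exact continuous_const

/-- The weighted error of the conditional prediction that the rule `c` tests. -/
noncomputable def checkedFeature (g : stdSimplex ℝ Ω → ℝ) (h : ForecastHistory Ω) (p : stdSimplex ℝ Ω)
    (c : CheckingRule Ω) (a : Ω) : ℝ :=
  g p * (c.active h).indicator 1 a *
    ((c.tested h).indicator 1 a - condEventProb p (c.tested h) (c.active h))

theorem indicator_one_mem_Icc {Y : Type*} (A : Set Y) (a : Y) :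
    A.indicator (1 : Y → ℝ) a ∈ Set.Icc (0 : ℝ) 1 := by
  by_cases ha : a ∈ A <;> simp [ha]

theorem abs_checkedFeature_le {g : stdSimplex ℝ Ω → ℝ} {C : ℝ} (hg : ∀ p, |g p| ≤ C)
    (h : ForecastHistory Ω) (p : stdSimplex ℝ Ω) (c : CheckingRule Ω) (a : Ω) :
    |checkedFeature g h p c a| ≤ C := by
  have h1 : |(c.active h).indicator (1 : Ω → ℝ) a| ≤ 1 := by
    have := indicator_one_mem_Icc (c.active h) a
    rw [abs_of_nonneg this.1]
    exact this.2
  have h2 : |(c.tested h).indicator (1 : Ω → ℝ) a -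
      condEventProb p (c.tested h) (c.active h)| ≤ 1 := by
    have h3 := indicator_one_mem_Icc (c.tested h) a
    have h4 := condEventProb_mem_Icc p (c.tested h) (c.active h)
    rw [abs_le]
    constructor <;> linarith [h3.1, h3.2, h4.1, h4.2]
  unfold checkedFeature
  rw [mul_assoc, abs_mul, abs_mul]
  calc |g p| * _ ≤ C * (1 * 1) :=
        mul_le_mul (hg p) (mul_le_mul h1 h2 (abs_nonneg _) zero_le_one) (by positivity)
          ((abs_nonneg _).trans (hg p))
    _ = C := by ring

/-- The quotient may be discontinuous where the active set has probability zero. For positive `p`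
this requires an empty active set, and then the indicator makes the feature vanish. -/
theorem continuousOn_checkedFeature {g : stdSimplex ℝ Ω → ℝ} (hg : Continuous g)
    (h : ForecastHistory Ω) (c : CheckingRule Ω) (a : Ω) :
    ContinuousOn (fun p => checkedFeature g h p c a) {p | ∀ a, 0 < p a} := by
  by_cases ha : a ∈ c.active h
  · refine (hg.continuousOn.mul continuousOn_const).mul (continuousOn_const.sub ?_)
    exact (continuous_eventProb _).continuousOn.div (continuous_eventProb _).continuousOn
      fun p hp => (eventProb_pos hp ha).ne'
  · simp only [checkedFeature, Set.indicator_of_notMem ha, mul_zero, zero_mul]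
    exact continuousOn_const

/-- This is the fairness that defensive forecasting needs: `p(T ∩ U) = p(U) p(T | U)`. -/
theorem sum_mul_checkedFeature (g : stdSimplex ℝ Ω → ℝ) (h : ForecastHistory Ω)
    {p : stdSimplex ℝ Ω} (hp : ∀ a, 0 < p a) (c : CheckingRule Ω) :
    ∑ a, p a * checkedFeature g h p c a = 0 := by
  set U := c.active h with hU
  set T := c.tested h with hT
  have h1 : ∀ a, p a * checkedFeature g h p c a =
      g p * ((T ∩ U).indicator (p : Ω → ℝ) a - U.indicator (p : Ω → ℝ) a * condEventProb p T U) := by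
    intro a
    by_cases ha : a ∈ U <;> by_cases hb : a ∈ T <;>
      simp [checkedFeature, ← hU, ← hT, ha, hb] <;> ring
  simp_rw [h1]
  rw [← Finset.mul_sum, Finset.sum_sub_distrib, ← Finset.sum_mul]
  change g p * (eventProb p (T ∩ U) - eventProb p U * condEventProb p T U) = 0
  have h2 : eventProb p U * condEventProb p T U = eventProb p (T ∩ U) := by
    rcases U.eq_empty_or_nonempty with h0 | ⟨a, ha⟩
    · simp [h0, eventProb]
    · exact mul_div_cancel₀ _ (eventProb_pos hp ha).ne'
  rw [h2, sub_self, mul_zero]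

/-- Only the values of the rule at `h` matter, and they range over a finite set. -/
theorem measurable_checkedFeature (g : stdSimplex ℝ Ω → ℝ) (h : ForecastHistory Ω)
    (p : stdSimplex ℝ Ω) (a : Ω) : Measurable fun c => checkedFeature g h p c a := by
  have h1 : Measurable fun c : CheckingRule Ω => (c.active h, c.tested h) :=
    (measurable_pi_apply h).comp
      (comap_measurable fun c : CheckingRule Ω => fun h => (c.active h, c.tested h))
  have h2 : Measurable fun q : Set Ω × Set Ω =>
      g p * q.1.indicator 1 a * (q.2.indicator 1 a - condEventProb p q.2 q.1) :=
    measurable_of_countable _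
  exact h2.comp h1

theorem checkedScore_eq (c : CheckingRule Ω) (g : stdSimplex ℝ Ω → ℝ) (σ : DetForecaster Ω)
    (ω : ℕ → Ω) (n : ℕ) :
    checkedScore c g σ ω n =
      |cumulativeFeature (checkedFeature g) (playHistory σ ω n) c / n| := by
  rw [cumulativeFeature_playHistory, abs_div, Nat.abs_cast, div_eq_inv_mul, ← one_div]
  rfl

/-- Calibration for a sequence of functions whose multiples are dense implies calibration for all
continuous functions. -/
theorem tendsto_checkedScore_of_approx {g : ℕ → C(stdSimplex ℝ Ω, ℝ)}
    (hg : ∀ f : stdSimplex ℝ Ω → ℝ, Continuous f → ∀ ε > 0, ∃ j, ∃ C : ℝ,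
      ∀ p, |f p - C * g j p| ≤ ε)
    {σ : DetForecaster Ω} {ω : ℕ → Ω} {c : CheckingRule Ω}
    (h : ∀ j, Tendsto (fun n : ℕ =>
      cumulativeFeature (checkedFeature (g j)) (playHistory σ ω n) c / n) atTop (𝓝 0))
    {f : stdSimplex ℝ Ω → ℝ} (hf : Continuous f) :
    Tendsto (checkedScore c f σ ω) atTop (𝓝 0) := by
  rw [Metric.tendsto_atTop]
  intro ε hε
  obtain ⟨j, C, hC⟩ := hg f hf (ε / 2) (by positivity)
  obtain ⟨N, hN⟩ := Metric.tendsto_atTop.1 ((h j).const_mul C) (ε / 2) (by positivity)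
  refine ⟨N, fun n hn => ?_⟩
  have h1 := hN n hn
  rw [mul_zero, Real.dist_0_eq_abs] at h1
  rw [Real.dist_0_eq_abs, checkedScore_eq, abs_abs]
  have h2 : |cumulativeFeature (checkedFeature f) (playHistory σ ω n) c -
      C * cumulativeFeature (checkedFeature (g j)) (playHistory σ ω n) c| ≤ n * (ε / 2) := by
    rw [cumulativeFeature_playHistory, cumulativeFeature_playHistory, Finset.mul_sum,
      ← Finset.sum_sub_distrib]
    refine (Finset.abs_sum_le_sum_abs _ _).trans ?_
    refine (Finset.sum_le_card_nsmul _ _ (ε / 2) fun m _ => ?_).trans (by simp)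
    have h3 := abs_checkedFeature_le hC (playHistory σ ω m) (prediction σ ω m) c (ω m)
    refine le_trans (le_of_eq ?_) h3
    congr 1
    simp only [checkedFeature]
    ring
  have h3 : |cumulativeFeature (checkedFeature f) (playHistory σ ω n) c / n -
      C * (cumulativeFeature (checkedFeature (g j)) (playHistory σ ω n) c / n)| ≤ ε / 2 := by
    rw [← mul_div_assoc, ← sub_div, abs_div, Nat.abs_cast]
    exact div_le_of_le_mul₀ (Nat.cast_nonneg n) (by positivity) (h2.trans_eq (mul_comm _ _))
  have h4 := abs_sub_abs_le_abs_sub (cumulativeFeature (checkedFeature f) (playHistory σ ω n) c / n)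
    (C * (cumulativeFeature (checkedFeature (g j)) (playHistory σ ω n) c / n))
  linarith

/-- The rule, active at all stages, that tests one outcome. -/
noncomputable def singletonRule (a : Ω) : CheckingRule Ω where
  active _ := Set.univ
  tested _ := {a}
  tested_subset_active _ := Set.subset_univ _

theorem checkedFeature_singletonRule (g : stdSimplex ℝ Ω → ℝ) (h : ForecastHistory Ω)
    (p : stdSimplex ℝ Ω) (a b : Ω) :
    checkedFeature g h p (singletonRule a) b = g p * (outcomeVec b a - p a) := by
  classical
  have h1 : eventProb p Set.univ = 1 := by
    simp only [eventProb, Set.indicator_univ]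
    exact p.2.2
  have h2 : eventProb p {a} = p a := by
    simp [eventProb, Set.indicator_apply]
  have h3 : ({a} : Set Ω).indicator (1 : Ω → ℝ) b = outcomeVec b a := by
    simp [outcomeVec, Set.indicator_apply, eq_comm]
  simp only [checkedFeature, singletonRule, condEventProb, Set.inter_univ, h1, h2, h3, div_one]
  simp

/-- Smooth calibration is calibration for the rules that test the single outcomes. -/
theorem tendsto_smoothScore {g : stdSimplex ℝ Ω → ℝ} {σ : DetForecaster Ω} {ω : ℕ → Ω}
    (h : ∀ a, Tendsto (checkedScore (singletonRule a) g σ ω) atTop (𝓝 0)) :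
    Tendsto (smoothScore g σ ω) atTop (𝓝 0) := by
  have h1 : Tendsto (fun n : ℕ => ∑ a, checkedScore (singletonRule a) g σ ω n) atTop (𝓝 0) := by
    simpa using tendsto_finsetSum Finset.univ fun a _ => h a
  refine squeeze_zero (fun n => by unfold smoothScore; positivity) (fun n => ?_) h1
  unfold smoothScore checkedScore
  rw [← Finset.mul_sum]
  refine mul_le_mul_of_nonneg_left ?_ (by positivity)
  have h2 : ∀ x : Ω → ℝ, ‖WithLp.toLp 2 x‖ ≤ ∑ a, |x a| := by
    intro x
    rw [EuclideanSpace.norm_eq]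
    refine Real.sqrt_le_iff.2 ⟨Finset.sum_nonneg fun _ _ => abs_nonneg _, ?_⟩
    exact Finset.sum_sq_le_sq_sum_of_nonneg fun a _ => abs_nonneg (x a)
  refine (h2 _).trans (Finset.sum_le_sum fun a _ => le_of_eq ?_)
  rw [Finset.sum_apply]
  congr 1
  refine Finset.sum_congr rfl fun m _ => ?_
  exact (checkedFeature_singletonRule g (playHistory σ ω m) (prediction σ ω m) a (ω m)).symm

/-- All functions and rules are tested at once, under the product of `ν` with a finite measure
charging each `j`; isolating `j` costs the factor `1 / w.real {j}`. The freedom in `ρ ≤ ν` later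
isolates either `μ` or one atom. -/
theorem exists_forecaster_checked [Nonempty Ω] {g : ℕ → C(stdSimplex ℝ Ω, ℝ)}
    (hg : ∀ j p, |g j p| ≤ 1) (ν : Measure (CheckingRule Ω)) [IsFiniteMeasure ν] :
    ∃ σ : DetForecaster Ω, (∀ h a, 0 < σ h a) ∧ ∀ j, ∃ C : ℝ, ∀ ρ ≤ ν, ∀ (ω : ℕ → Ω) (n : ℕ),
      ∫ c, cumulativeFeature (checkedFeature (g j)) (playHistory σ ω n) c ^ 2 ∂ρ ≤ C * n := by
  set w : Measure ℕ := (Measure.count : Measure ℕ).toFinite with hw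
  have hw0 : ∀ j, 0 < w.real {j} := by
    intro j
    refine ENNReal.toReal_pos (fun h0 => ?_) (measure_ne_top _ _)
    have := absolutelyContinuous_toFinite (Measure.count : Measure ℕ) h0
    simp at this
  set X : ForecastHistory Ω → stdSimplex ℝ Ω → ℕ × CheckingRule Ω → Ω → ℝ :=
    fun h p i a => checkedFeature (g i.1) h p i.2 a with hX
  have hXm : ∀ h p a, Measurable fun i => X h p i a := fun h p a =>
    measurable_from_prod_countable_right fun j => measurable_checkedFeature (g j) h p a
  have hXb : ∀ h p i a, |X h p i a| ≤ 1 := fun h p i a =>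
    abs_checkedFeature_le (hg i.1) h p i.2 a
  obtain ⟨σ, hσ, hbound⟩ := exists_forecaster_integral_sq_le (w.prod ν) X hXm hXb
    (fun h i a => continuousOn_checkedFeature (g i.1).continuous h i.2 a)
    (fun h p i hp => sum_mul_checkedFeature (g i.1) h hp i.2)
  refine ⟨σ, hσ, fun j => ⟨(2 + (w.prod ν).real Set.univ) / w.real {j}, fun ρ hρ ω n => ?_⟩⟩
  have h1 := hbound ω n
  set S := cumulativeFeature X (playHistory σ ω n) with hS
  have hSint : Integrable (fun i => S i ^ 2) (w.prod ν) := by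
    refine Integrable.of_bound
      ((measurable_cumulativeFeature hXm _).pow_const 2).aestronglyMeasurable
      (((playHistory σ ω n).length : ℝ) ^ 2) (Eventually.of_forall fun i => ?_)
    rw [norm_pow, Real.norm_eq_abs]
    exact pow_le_pow_left₀ (abs_nonneg _) (abs_cumulativeFeature_le hXb _ i) 2
  rw [integral_prod _ hSint] at h1
  have h2 := setIntegral_le_integral (s := {j}) hSint.integral_prod_left
    (Eventually.of_forall fun k => integral_nonneg fun c => sq_nonneg _)
  rw [integral_singleton, smul_eq_mul] at h2
  have hjm : Measurable fun c => S (j, c) :=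
    (measurable_cumulativeFeature hXm _).comp measurable_prodMk_left
  have hjint : Integrable (fun c => S (j, c) ^ 2) ν := by
    refine Integrable.of_bound (hjm.pow_const 2).aestronglyMeasurable
      (((playHistory σ ω n).length : ℝ) ^ 2) (Eventually.of_forall fun i => ?_)
    rw [norm_pow, Real.norm_eq_abs]
    exact pow_le_pow_left₀ (abs_nonneg _) (abs_cumulativeFeature_le hXb _ _) 2
  have h3 : ∫ c, S (j, c) ^ 2 ∂ρ ≤ ∫ c, S (j, c) ^ 2 ∂ν :=
    integral_mono_measure hρ (Eventually.of_forall fun c => sq_nonneg _) hjint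
  rw [div_mul_eq_mul_div, le_div_iff₀ (hw0 j)]
  calc _ = (∫ c, S (j, c) ^ 2 ∂ρ) * w.real {j} := rfl
    _ ≤ (∫ c, S (j, c) ^ 2 ∂ν) * w.real {j} := by gcongr
    _ ≤ _ := by linarith

theorem playHistory_congr (σ : DetForecaster Ω) {ω ω' : ℕ → Ω} {n : ℕ}
    (h : ∀ m < n, ω m = ω' m) : playHistory σ ω n = playHistory σ ω' n := by
  induction n with
  | zero => rfl
  | succ n ih =>
    rw [playHistory, playHistory, ih fun m hm => h m (hm.trans n.lt_succ_self), h n n.lt_succ_self]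

theorem length_playHistory (σ : DetForecaster Ω) (ω : ℕ → Ω) (n : ℕ) :
    (playHistory σ ω n).length = n := by
  induction n with
  | zero => rfl
  | succ n ih => rw [playHistory, List.length_append, ih, List.length_singleton]

/-- `σ` need not be measurable: the history depends on the first `n` outcomes only, which take
finitely many values. -/
theorem measurable_cumulativeFeature_playHistory [Nonempty Ω] [MeasurableSpace Ω]
    [DiscreteMeasurableSpace Ω] {I : Type*} [MeasurableSpace I]
    {X : ForecastHistory Ω → stdSimplex ℝ Ω → I → Ω → ℝ}
    (hm : ∀ h p a, Measurable fun i => X h p i a) (σ : DetForecaster Ω) (n : ℕ) :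
    Measurable fun z : I × (ℕ → Ω) => cumulativeFeature X (playHistory σ z.2 n) z.1 := by
  set ext : (Fin n → Ω) → ℕ → Ω := fun w m =>
    if h : m < n then w ⟨m, h⟩ else Classical.arbitrary Ω with hext
  have h1 : Measurable fun z : I × (Fin n → Ω) =>
      cumulativeFeature X (playHistory σ (ext z.2) n) z.1 :=
    measurable_from_prod_countable_left fun w =>
      measurable_cumulativeFeature hm (playHistory σ (ext w) n)
  have h2 : Measurable fun z : I × (ℕ → Ω) => (z.1, fun m : Fin n => z.2 m) := by fun_prop
  convert h1.comp h2 using 2 with z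
  simp only [Function.comp]
  rw [playHistory_congr σ (ω := z.2) (ω' := ext fun m : Fin n => z.2 m) fun k hk => by
    simp [hext, hk]]

/-- If the mean square score over the rules is of linear order along every play, then the score of
almost every rule is almost surely sublinear. -/
theorem ae_ae_tendsto_cumulativeFeature [Nonempty Ω] [MeasurableSpace Ω]
    [DiscreteMeasurableSpace Ω] {I : Type*} [MeasurableSpace I] {μ : Measure I} [IsFiniteMeasure μ]
    {X : ForecastHistory Ω → stdSimplex ℝ Ω → I → Ω → ℝ}
    (hm : ∀ h p a, Measurable fun i => X h p i a) (hb : ∀ h p i a, |X h p i a| ≤ 1)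
    {σ : DetForecaster Ω} {C : ℝ}
    (hC : ∀ (ω : ℕ → Ω) (n : ℕ),
      ∫ i, cumulativeFeature X (playHistory σ ω n) i ^ 2 ∂μ ≤ C * n)
    (P : Measure (ℕ → Ω)) [IsProbabilityMeasure P] :
    ∀ᵐ i ∂μ, ∀ᵐ ω ∂P, Tendsto (fun n : ℕ =>
      cumulativeFeature X (playHistory σ ω n) i / n) atTop (𝓝 0) := by
  set T : ℕ → I × (ℕ → Ω) → ℝ := fun n z => cumulativeFeature X (playHistory σ z.2 n) z.1 with hT
  have hTm : ∀ n, Measurable (T n) := measurable_cumulativeFeature_playHistory hm σ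
  have hTb : ∀ n z, |T n z| ≤ n := fun n z => by
    simpa [length_playHistory] using abs_cumulativeFeature_le hb (playHistory σ z.2 n) z.1
  refine Measure.ae_ae_of_ae_prod
    (p := fun z => Tendsto (fun n : ℕ => T n z / n) atTop (𝓝 0))
    (ae_tendsto_div_of_integral_sq_le hTm hTb (fun n z => ?_) (C := C) fun n => ?_)
  · simp only [hT, playHistory, cumulativeFeature_append, add_sub_cancel_left]
    exact hb _ _ _ _
  · have hint : Integrable (fun z => T n z ^ 2) (μ.prod P) := by
      refine Integrable.of_bound ((hTm n).pow_const 2).aestronglyMeasurable ((n : ℝ) ^ 2)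
        (Eventually.of_forall fun z => ?_)
      rw [norm_pow, Real.norm_eq_abs]
      exact pow_le_pow_left₀ (abs_nonneg _) (hTb n z) 2
    -- The inner integral is now over the rules, where `hC` applies to each play, whatever its law
    -- `P`.
    rw [integral_prod_symm _ hint]
    refine (integral_mono_of_nonneg (Eventually.of_forall fun ω =>
      integral_nonneg fun i => sq_nonneg _) (integrable_const (C * n))
      (Eventually.of_forall fun ω => hC ω n)).trans ?_
    simp

instance isProbabilityMeasure_playLaw [MeasurableSpace Ω] [DiscreteMeasurableSpace Ω]
    (σ : DetForecaster Ω) (τ : NatureStrategy Ω) : IsProbabilityMeasure (playLaw σ τ) := by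
  unfold playLaw
  infer_instance

/-- One forecaster for the smooth score and for random checking rules. -/
theorem exists_forecaster_calibrated [Nonempty Ω] [MeasurableSpace Ω] [DiscreteMeasurableSpace Ω]
    (μ : Measure (CheckingRule Ω)) [IsFiniteMeasure μ] :
    ∃ σ : DetForecaster Ω,
      (∀ ω : ℕ → Ω, ∀ g : stdSimplex ℝ Ω → ℝ, Continuous g → (∀ p, 0 ≤ g p) →
        Tendsto (smoothScore g σ ω) atTop (𝓝 0)) ∧
      (∀ τ : NatureStrategy Ω, ∀ᵐ c ∂μ, ∀ᵐ ω ∂(playLaw σ τ),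
        ConditionalsDefined c σ ω ∧
        ∀ g : stdSimplex ℝ Ω → ℝ, Continuous g → (∀ p, 0 ≤ g p) →
          Tendsto (checkedScore c g σ ω) atTop (𝓝 0)) := by
  obtain ⟨g, hg1, hg⟩ := exists_bounded_seq_approx (stdSimplex ℝ Ω)
  -- The atoms turn a mean bound over rules into a bound for each single outcome, valid on every
  -- sequence.
  set ν : Measure (CheckingRule Ω) := μ + Measure.sum fun a => Measure.dirac (singletonRule a)
    with hν
  obtain ⟨σ, hσ, hbound⟩ := exists_forecaster_checked hg1 ν
  have hfeat : ∀ j h p a, Measurable fun c => checkedFeature (g j) h p c a :=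
    fun j => measurable_checkedFeature (g j)
  refine ⟨σ, fun ω f hf _ => tendsto_smoothScore fun a => ?_, fun τ => ?_⟩
  · refine tendsto_checkedScore_of_approx hg (fun j => ?_) hf
    obtain ⟨C, hC⟩ := hbound j
    have hle : Measure.dirac (singletonRule a) ≤ ν :=
      (Measure.le_sum (fun a : Ω => Measure.dirac (singletonRule a)) a).trans
        (Measure.le_add_left le_rfl)
    set t : ℕ → ℝ := fun n =>
      cumulativeFeature (checkedFeature (g j)) (playHistory σ ω n) (singletonRule a) with ht
    have hsq : ∀ n, t n ^ 2 ≤ C * n := fun n => by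
      have h1 := hC _ hle ω n
      rwa [integral_dirac' _ _
        ((measurable_cumulativeFeature (hfeat j) _).pow_const 2).stronglyMeasurable] at h1
    have hsqrt : Tendsto (fun n : ℕ => √(C / n)) atTop (𝓝 0) := by
      simpa using (tendsto_const_div_atTop_nhds_zero_nat C).sqrt
    refine squeeze_zero_norm' ?_ hsqrt
    filter_upwards [eventually_gt_atTop 0] with n hn
    have hn0 : (0 : ℝ) < n := by exact_mod_cast hn
    refine Real.abs_le_sqrt ?_
    rw [div_pow, div_le_div_iff₀ (by positivity) hn0]
    nlinarith [hsq n]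
  · have hae : ∀ j, ∀ᵐ c ∂μ, ∀ᵐ ω ∂(playLaw σ τ), Tendsto (fun n : ℕ =>
        cumulativeFeature (checkedFeature (g j)) (playHistory σ ω n) c / n) atTop (𝓝 0) := by
      intro j
      obtain ⟨C, hC⟩ := hbound j
      exact ae_ae_tendsto_cumulativeFeature (hfeat j)
        (fun h p c a => abs_checkedFeature_le (hg1 j) h p c a)
        (hC μ (Measure.le_add_right le_rfl)) _
    -- Countably many `j` leave one null set that serves all continuous functions.
    filter_upwards [ae_all_iff.2 hae] with c hc
    filter_upwards [ae_all_iff.2 hc] with ω hω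
    exact ⟨fun m hm => eventProb_pos (hσ _) hm, fun f hf _ =>
      tendsto_checkedScore_of_approx hg hω hf⟩

end Checking

theorem mainTheorem11 {Ω : Type*} [Fintype Ω] [Nonempty Ω] [MeasurableSpace Ω]
    [DiscreteMeasurableSpace Ω] :
    -- one deterministic strategy, good against every sequence of outcomes
    (∃ σ : DetForecaster Ω, ∀ ω : ℕ → Ω,
      ∀ g : stdSimplex ℝ Ω → ℝ, Continuous g → (∀ p, 0 ≤ g p) →
        Tendsto (smoothScore g σ ω) atTop (𝓝 0)) ∧
    -- the same with checking rules drawn from a probability distribution added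
    (∀ (μ : Measure (CheckingRule Ω)) [IsProbabilityMeasure μ],
      ∃ σ : DetForecaster Ω,
        (∀ ω : ℕ → Ω, ∀ g : stdSimplex ℝ Ω → ℝ, Continuous g → (∀ p, 0 ≤ g p) →
          Tendsto (smoothScore g σ ω) atTop (𝓝 0)) ∧
        (∀ τ : NatureStrategy Ω, ∀ᵐ c ∂μ, ∀ᵐ ω ∂(playLaw σ τ),
          ConditionalsDefined c σ ω ∧
          ∀ g : stdSimplex ℝ Ω → ℝ, Continuous g → (∀ p, 0 ≤ g p) →
            Tendsto (checkedScore c g σ ω) atTop (𝓝 0))) := by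
  refine ⟨?_, fun μ _ => exists_forecaster_calibrated μ⟩
  -- For `μ = 0` only the atoms at single outcomes are tested.
  obtain ⟨σ, hσ, -⟩ := exists_forecaster_calibrated (0 : Measure (CheckingRule Ω))
  exact ⟨σ, hσ⟩
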